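/- Let $K$ and $H$ be complex Hilbert spaces with $H$ separable, and let $A\subseteq B(K)$ be an operator system, i.e. a norm closed, self-adjoint linear space of bounded operators on $K$ containing the identity. Let $T(H)$ be the space of trace class operators on $H$ with the trace norm, $A\widehat\otimes T(H)$ the (completed) projective tensor product, and $b\mapsto b^t$ the transpose on $B(H)$ with respect to an orthonormal basis of $H$. For a bounded linear map $\phi\colon A\to B(H)$ let $\tilde\phi\in (A\widehat\otimes T(H))^*$ be the bounded linear functional determined by $$\tilde\phi(a\otimes b)=\mathrm{Tr}(\phi(a)b^t),\qquad a\in A,\ b\in T(H).$$ Call an element of $(A\widehat\otimes T(H))^*$ separable if it belongs to the weak-* closure of the cone of finite sums $\sum_i c_i\,\sigma_i\otimes\omega_i$, where $c_i\ge 0$, the $\sigma_i$ are states of $A$, the $\omega_i$ are normal states of $B(H)$, and $(\sigma\otimes\omega)(a\otimes b)=\sigma(a)\omega(b)$. If $\phi\colon A\to B(H)$ is bounded, linear and positive (it maps positive operators in $A$ to positive operators), and $\phi(A)$ is contained in an abelian $C^*$-subalgebra of $B(H)$, then $\tilde\phi$ is separable. -/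

import Mathlib

open scoped TensorProduct ComplexOrder
open UniformSpace

/-! ### Norms defined as infima of costs of representations -/

/-- If `cost x` is, for each vector `x`, a non-empty set of non-negative numbers, compatible with
addition and with multiplication by scalars, then `x ↦ inf (cost x)` is a seminorm. -/
theorem infCost_core {E : Type*} [AddCommGroup E] [Module ℂ E] [Norm E] (cost : E → Set ℝ)
    (hnorm : ∀ x, ‖x‖ = sInf (cost x)) (hne : ∀ x, (cost x).Nonempty)
    (hpos : ∀ x, ∀ r ∈ cost x, 0 ≤ r)
    (hadd : ∀ x y, ∀ r ∈ cost x, ∀ s ∈ cost y, r + s ∈ cost (x + y))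
    (hsmul : ∀ (c : ℂ) (x : E), ∀ r ∈ cost x, ‖c‖ * r ∈ cost (c • x)) :
    SeminormedSpace.Core ℂ E := by
  have hbdd : ∀ x, BddBelow (cost x) := fun x => ⟨0, fun r hr => hpos x r hr⟩
  have hle : ∀ x, ∀ r ∈ cost x, ‖x‖ ≤ r := fun x r hr => by
    rw [hnorm]; exact csInf_le (hbdd x) hr
  have hnn : ∀ x : E, 0 ≤ ‖x‖ := fun x => by
    rw [hnorm]; exact le_csInf (hne x) (hpos x)
  have hsm : ∀ (c : ℂ) (x : E), ‖c • x‖ ≤ ‖c‖ * ‖x‖ := by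
    intro c x
    refine le_of_forall_pos_le_add fun ε hε => ?_
    have hδ : 0 < ε / (‖c‖ + 1) := by positivity
    obtain ⟨r, hr, hlt⟩ := exists_lt_of_csInf_lt (hne x)
      (show sInf (cost x) < ‖x‖ + ε / (‖c‖ + 1) by rw [hnorm]; linarith)
    have h1 := hle _ _ (hsmul c x r hr)
    have h2 : ‖c‖ * r ≤ ‖c‖ * (‖x‖ + ε / (‖c‖ + 1)) :=
      mul_le_mul_of_nonneg_left hlt.le (norm_nonneg c)
    have h3 : ‖c‖ * (ε / (‖c‖ + 1)) ≤ ε := by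
      rw [mul_div_assoc', div_le_iff₀ (by positivity)]
      nlinarith [norm_nonneg c]
    linarith [mul_add ‖c‖ ‖x‖ (ε / (‖c‖ + 1))]
  refine ⟨hnn, fun c x => le_antisymm (hsm c x) ?_, fun x y => ?_⟩
  · rcases eq_or_ne c 0 with rfl | hc
    · simpa using hnn ((0 : ℂ) • x)
    · have h := hsm c⁻¹ (c • x)
      rw [smul_smul, inv_mul_cancel₀ hc, one_smul, norm_inv] at h
      have hc' : 0 < ‖c‖ := norm_pos_iff.2 hc
      calc ‖c‖ * ‖x‖ ≤ ‖c‖ * (‖c‖⁻¹ * ‖c • x‖) := mul_le_mul_of_nonneg_left h hc'.le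
        _ = ‖c • x‖ := by rw [← mul_assoc, mul_inv_cancel₀ hc'.ne', one_mul]
  · refine le_of_forall_pos_le_add fun ε hε => ?_
    obtain ⟨r, hr, hr'⟩ := exists_lt_of_csInf_lt (hne x)
      (show sInf (cost x) < ‖x‖ + ε / 2 by rw [hnorm]; linarith)
    obtain ⟨s, hs, hs'⟩ := exists_lt_of_csInf_lt (hne y)
      (show sInf (cost y) < ‖y‖ + ε / 2 by rw [hnorm]; linarith)
    linarith [hle _ _ (hadd x y r hr s hs)]

/-! ### The projective tensor product of two normed spaces -/

section Projective

variable (E F : Type*) [NormedAddCommGroup E] [NormedSpace ℂ E]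
  [NormedAddCommGroup F] [NormedSpace ℂ F]

/-- The algebraic tensor product `E ⊙ F`, to be equipped with the projective norm. -/
def AlgProj : Type _ := E ⊗[ℂ] F

noncomputable instance : AddCommGroup (AlgProj E F) := inferInstanceAs (AddCommGroup (E ⊗[ℂ] F))

noncomputable instance : Module ℂ (AlgProj E F) := inferInstanceAs (Module ℂ (E ⊗[ℂ] F))

variable {E F}

/-- The elementary tensor `a ⊗ b`. -/
noncomputable def AlgProj.tmul (a : E) (b : F) : AlgProj E F := a ⊗ₜ[ℂ] b

/-- The numbers `∑ ‖aᵢ‖ ‖bᵢ‖` over all finite representations `z = ∑ aᵢ ⊗ bᵢ`. -/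
def AlgProj.cost (z : AlgProj E F) : Set ℝ :=
  {r | ∃ l : List (E × F), z = (l.map fun p => AlgProj.tmul p.1 p.2).sum ∧
    r = (l.map fun p => ‖p.1‖ * ‖p.2‖).sum}

/-- The projective norm `‖z‖ = inf {∑ ‖aᵢ‖ ‖bᵢ‖ : z = ∑ aᵢ ⊗ bᵢ}`. -/
noncomputable instance : Norm (AlgProj E F) := ⟨fun z => sInf (AlgProj.cost z)⟩

theorem AlgProj.exists_list (z : AlgProj E F) :
    ∃ l : List (E × F), z = (l.map fun p => AlgProj.tmul p.1 p.2).sum := by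
  refine TensorProduct.induction_on (R := ℂ) (M := E) (N := F)
    (motive := fun z => ∃ l : List (E × F),
      (z : AlgProj E F) = (l.map fun p => AlgProj.tmul p.1 p.2).sum) z ⟨[], rfl⟩ ?_ ?_
  · intro a b
    refine ⟨[(a, b)], ?_⟩
    rw [List.map_singleton, List.sum_singleton]
    rfl
  · rintro x y ⟨l, hl⟩ ⟨m, hm⟩
    refine ⟨l ++ m, ?_⟩
    rw [List.map_append, List.sum_append, ← hl, ← hm]
    rfl

theorem AlgProj.smul_tmul (c : ℂ) (a : E) (b : F) :
    c • AlgProj.tmul a b = AlgProj.tmul (c • a) b := rfl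

theorem AlgProj.core : SeminormedSpace.Core ℂ (AlgProj E F) := by
  refine infCost_core AlgProj.cost (fun _ => rfl) ?_ ?_ ?_ ?_
  · intro z
    obtain ⟨l, hl⟩ := AlgProj.exists_list z
    exact ⟨_, l, hl, rfl⟩
  · rintro z r ⟨l, -, rfl⟩
    refine List.sum_nonneg ?_
    simp only [List.mem_map, forall_exists_index, and_imp]
    rintro _ p - rfl
    positivity
  · rintro x y r ⟨l, hl, rfl⟩ s ⟨m, hm, rfl⟩
    exact ⟨l ++ m, by rw [List.map_append, List.sum_append, ← hl, ← hm], by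
      rw [List.map_append, List.sum_append]⟩
  · rintro c x r ⟨l, hl, rfl⟩
    refine ⟨l.map fun p => (c • p.1, p.2), ?_, ?_⟩
    · rw [hl, List.smul_sum, List.map_map, List.map_map]
      rfl
    · rw [List.map_map, ← List.sum_map_mul_left]
      congr 1
      refine List.map_congr_left fun p _ => ?_
      simp [norm_smul, mul_assoc]

noncomputable instance : SeminormedAddCommGroup (AlgProj E F) :=
  SeminormedAddCommGroup.ofCore AlgProj.core

noncomputable instance : NormedSpace ℂ (AlgProj E F) where
  norm_smul_le c x := (AlgProj.core.norm_smul c x).le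

/-- The linear functional on `E ⊙ F` given by a bounded bilinear form. -/
noncomputable def AlgProj.liftₗ (B : E →L[ℂ] F →L[ℂ] ℂ) : AlgProj E F →ₗ[ℂ] ℂ :=
  TensorProduct.lift ((ContinuousLinearMap.coeLM ℂ).comp B.toLinearMap)

theorem AlgProj.liftₗ_tmul (B : E →L[ℂ] F →L[ℂ] ℂ) (a : E) (b : F) :
    AlgProj.liftₗ B (AlgProj.tmul a b) = B a b :=
  TensorProduct.lift.tmul (f' := (ContinuousLinearMap.coeLM ℂ).comp B.toLinearMap) a b

theorem AlgProj.norm_liftₗ_le (B : E →L[ℂ] F →L[ℂ] ℂ) (z : AlgProj E F) :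
    ‖AlgProj.liftₗ B z‖ ≤ ‖B‖ * ‖z‖ := by
  have key : ∀ l : List (E × F), ‖AlgProj.liftₗ B (l.map fun p => AlgProj.tmul p.1 p.2).sum‖
      ≤ ‖B‖ * (l.map fun p => ‖p.1‖ * ‖p.2‖).sum := by
    intro l
    induction l with
    | nil => simp
    | cons p l ih =>
      simp only [List.map_cons, List.sum_cons, map_add, AlgProj.liftₗ_tmul, mul_add]
      refine (norm_add_le _ _).trans (add_le_add ?_ ih)
      rw [← mul_assoc]
      exact B.le_opNorm₂ p.1 p.2
  refine le_of_forall_pos_le_add fun ε hε => ?_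
  have hne : (AlgProj.cost z).Nonempty := by
    obtain ⟨l, hl⟩ := AlgProj.exists_list z
    exact ⟨_, l, hl, rfl⟩
  obtain ⟨r, ⟨l, hl, rfl⟩, hlt⟩ := exists_lt_of_csInf_lt hne
    (show sInf (AlgProj.cost z) < ‖z‖ + ε / (‖B‖ + 1) from
      lt_add_of_pos_right _ (by positivity))
  have h1 := key l
  rw [← hl] at h1
  have h2 := mul_le_mul_of_nonneg_left hlt.le (norm_nonneg B)
  have h3 : ‖B‖ * (ε / (‖B‖ + 1)) ≤ ε := by
    rw [mul_div_assoc', div_le_iff₀ (by positivity)]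
    nlinarith [norm_nonneg B]
  linarith [mul_add ‖B‖ ‖z‖ (ε / (‖B‖ + 1))]

variable (E F) in
/-- The projective tensor product `E ⊗̂ F`: the completion of `E ⊙ F` in the projective norm. -/
abbrev ProjTensor : Type _ := Completion (AlgProj E F)

/-- The elementary tensor `a ⊗ b` in `E ⊗̂ F`. -/
noncomputable def ProjTensor.tmul (a : E) (b : F) : ProjTensor E F :=
  ((AlgProj.tmul a b : AlgProj E F) : Completion (AlgProj E F))

/-- The bounded linear functional on `E ⊗̂ F` that corresponds to the bounded bilinear form `B`. -/
noncomputable def ProjTensor.lift (B : E →L[ℂ] F →L[ℂ] ℂ) : StrongDual ℂ (ProjTensor E F) :=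
  ((AlgProj.liftₗ B).mkContinuous ‖B‖ (AlgProj.norm_liftₗ_le B)).extend
    (Completion.toComplL : AlgProj E F →L[ℂ] Completion (AlgProj E F))

@[simp]
theorem ProjTensor.lift_tmul (B : E →L[ℂ] F →L[ℂ] ℂ) (a : E) (b : F) :
    ProjTensor.lift B (ProjTensor.tmul a b) = B a b := by
  have h := ContinuousLinearMap.extend_eq
    ((AlgProj.liftₗ B).mkContinuous ‖B‖ (AlgProj.norm_liftₗ_le B))
    (e := (Completion.toComplL : AlgProj E F →L[ℂ] Completion (AlgProj E F)))
    Completion.denseRange_coe (Completion.isUniformInducing_coe _) (AlgProj.tmul a b)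
  exact h.trans (AlgProj.liftₗ_tmul B a b)

end Projective

/-! ### Trace class operators -/

section TraceClass

variable {H : Type*} [NormedAddCommGroup H] [InnerProductSpace ℂ H]

/-- `b = ∑ₙ ⟨yₙ, ·⟩ xₙ` with `∑ₙ ‖xₙ‖ ‖yₙ‖ < ∞`. -/
def IsNuclearRep (b : H →L[ℂ] H) (x y : ℕ → H) : Prop :=
  (Summable fun n => ‖x n‖ * ‖y n‖) ∧ ∀ v, HasSum (fun n => inner ℂ (y n) v • x n) (b v)

theorem IsNuclearRep.zero : IsNuclearRep (0 : H →L[ℂ] H) 0 0 := by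
  constructor
  · simp
  · intro v
    simp

theorem IsNuclearRep.add {b c : H →L[ℂ] H} {x y x' y' : ℕ → H} (hb : IsNuclearRep b x y)
    (hc : IsNuclearRep c x' y') : ∃ x'' y'' : ℕ → H, IsNuclearRep (b + c) x'' y'' ∧
      ∑' n, ‖x'' n‖ * ‖y'' n‖ = (∑' n, ‖x n‖ * ‖y n‖) + ∑' n, ‖x' n‖ * ‖y' n‖ := by
  let e := Equiv.natSumNatEquivNat
  have h1 : HasSum (fun n => ‖Sum.elim x x' (e.symm n)‖ * ‖Sum.elim y y' (e.symm n)‖)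
      ((∑' n, ‖x n‖ * ‖y n‖) + ∑' n, ‖x' n‖ * ‖y' n‖) := by
    refine (e.symm.hasSum_iff (f := fun k => ‖Sum.elim x x' k‖ * ‖Sum.elim y y' k‖)).2 ?_
    exact HasSum.sum hb.1.hasSum hc.1.hasSum
  refine ⟨fun n => Sum.elim x x' (e.symm n), fun n => Sum.elim y y' (e.symm n),
    ⟨h1.summable, fun v => ?_⟩, h1.tsum_eq⟩
  refine (e.symm.hasSum_iff
    (f := fun k => inner ℂ (Sum.elim y y' k) v • Sum.elim x x' k)).2 ?_
  exact HasSum.sum (hb.2 v) (hc.2 v)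

/-- Composition with a bounded operator on the left. -/
theorem IsNuclearRep.comp_left {b : H →L[ℂ] H} {x y : ℕ → H} (hb : IsNuclearRep b x y)
    (c : H →L[ℂ] H) : IsNuclearRep (c * b) (fun n => c (x n)) y := by
  refine ⟨Summable.of_nonneg_of_le (fun n => by positivity) (fun n => ?_) (hb.1.mul_left ‖c‖),
    fun v => ?_⟩
  · rw [← mul_assoc]
    exact mul_le_mul_of_nonneg_right (c.le_opNorm _) (norm_nonneg _)
  · simpa using (hb.2 v).mapL c

theorem IsNuclearRep.smul {b : H →L[ℂ] H} {x y : ℕ → H} (hb : IsNuclearRep b x y)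
    (c : ℂ) : IsNuclearRep (c • b) (fun n => c • x n) y := by
  have h := hb.comp_left (c • (1 : H →L[ℂ] H))
  simpa using h

theorem IsNuclearRep.norm_le {b : H →L[ℂ] H} {x y : ℕ → H} (hb : IsNuclearRep b x y) :
    ‖b‖ ≤ ∑' n, ‖x n‖ * ‖y n‖ := by
  refine b.opNorm_le_bound (tsum_nonneg fun n => by positivity) fun v => ?_
  have hle : ∀ n, ‖inner ℂ (y n) v • x n‖ ≤ ‖x n‖ * ‖y n‖ * ‖v‖ := fun n => by
    rw [norm_smul]
    calc ‖inner ℂ (y n) v‖ * ‖x n‖ ≤ (‖y n‖ * ‖v‖) * ‖x n‖ :=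
          mul_le_mul_of_nonneg_right (norm_inner_le_norm _ _) (norm_nonneg _)
      _ = _ := by ring
  rw [← (hb.2 v).tsum_eq, ← tsum_mul_right]
  exact tsum_of_norm_bounded (hb.1.mul_right ‖v‖).hasSum hle

variable (H) in
/-- The space of trace class (that is, nuclear) operators on a Hilbert space, as a linear space of
bounded operators. -/
def traceClassSubmodule : Submodule ℂ (H →L[ℂ] H) where
  carrier := {b | ∃ x y, IsNuclearRep b x y}
  zero_mem' := ⟨0, 0, IsNuclearRep.zero⟩
  add_mem' := by
    rintro b c ⟨x, y, h⟩ ⟨x', y', h'⟩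
    obtain ⟨x'', y'', h'', -⟩ := h.add h'
    exact ⟨x'', y'', h''⟩
  smul_mem' := by
    rintro c b ⟨x, y, h⟩
    exact ⟨_, _, h.smul c⟩

variable (H) in
/-- The space `T(H)` of trace class operators on `H`, to be equipped with the trace norm. -/
def TraceClass : Type _ := traceClassSubmodule H

noncomputable instance : AddCommGroup (TraceClass H) :=
  inferInstanceAs (AddCommGroup (traceClassSubmodule H))

noncomputable instance : Module ℂ (TraceClass H) :=
  inferInstanceAs (Module ℂ (traceClassSubmodule H))

/-- The underlying bounded operator of a trace class operator. -/
def TraceClass.opₗ : TraceClass H →ₗ[ℂ] (H →L[ℂ] H) := (traceClassSubmodule H).subtype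

theorem TraceClass.opₗ_injective : Function.Injective (TraceClass.opₗ (H := H)) :=
  Subtype.val_injective

theorem TraceClass.exists_rep (b : TraceClass H) :
    ∃ x y, IsNuclearRep (TraceClass.opₗ b) x y := b.2

/-- The numbers `∑ₙ ‖xₙ‖ ‖yₙ‖` over all representations `b = ∑ₙ ⟨yₙ, ·⟩ xₙ`. -/
def TraceClass.cost (b : TraceClass H) : Set ℝ :=
  {r | ∃ x y, IsNuclearRep (TraceClass.opₗ b) x y ∧ r = ∑' n, ‖x n‖ * ‖y n‖}

/-- The trace norm `‖b‖₁ = inf {∑ₙ ‖xₙ‖ ‖yₙ‖ : b = ∑ₙ ⟨yₙ, ·⟩ xₙ}`. -/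
noncomputable instance : Norm (TraceClass H) := ⟨fun b => sInf (TraceClass.cost b)⟩

theorem TraceClass.cost_nonempty (b : TraceClass H) : (TraceClass.cost b).Nonempty := by
  obtain ⟨x, y, h⟩ := b.exists_rep
  exact ⟨_, x, y, h, rfl⟩

theorem TraceClass.norm_op_le (b : TraceClass H) : ‖TraceClass.opₗ b‖ ≤ ‖b‖ := by
  refine le_csInf b.cost_nonempty ?_
  rintro r ⟨x, y, h, rfl⟩
  exact h.norm_le

theorem TraceClass.core : NormedSpace.Core ℂ (TraceClass H) where
  toCore := by
    refine infCost_core TraceClass.cost (fun _ => rfl) TraceClass.cost_nonempty ?_ ?_ ?_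
    · rintro b r ⟨x, y, -, rfl⟩
      exact tsum_nonneg fun n => by positivity
    · rintro b c r ⟨x, y, h, rfl⟩ s ⟨x', y', h', rfl⟩
      obtain ⟨x'', y'', h'', he⟩ := h.add h'
      exact ⟨x'', y'', by rwa [map_add], he.symm⟩
    · rintro c b r ⟨x, y, h, rfl⟩
      refine ⟨_, y, by rw [map_smul]; exact h.smul c, ?_⟩
      rw [← tsum_mul_left]
      simp [norm_smul, mul_assoc]
  norm_eq_zero_iff b := by
    constructor
    · intro h
      have := b.norm_op_le
      rw [h, norm_le_zero_iff] at this
      exact TraceClass.opₗ_injective (by rw [this, map_zero])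
    · rintro rfl
      refine le_antisymm (csInf_le ⟨0, ?_⟩ ⟨0, 0, ?_, ?_⟩) (le_csInf (TraceClass.cost_nonempty _) ?_)
      · rintro r ⟨x, y, -, rfl⟩
        exact tsum_nonneg fun n => by positivity
      · rw [map_zero]; exact IsNuclearRep.zero
      · simp
      · rintro r ⟨x, y, -, rfl⟩
        exact tsum_nonneg fun n => by positivity

noncomputable instance : NormedAddCommGroup (TraceClass H) :=
  NormedAddCommGroup.ofCore TraceClass.core

noncomputable instance : NormedSpace ℂ (TraceClass H) where
  norm_smul_le c x := (TraceClass.core.norm_smul c x).le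

/-- The inclusion `T(H) → B(H)` as a bounded linear map. -/
noncomputable def TraceClass.op : TraceClass H →L[ℂ] (H →L[ℂ] H) :=
  TraceClass.opₗ.mkContinuous 1 fun b => by simpa using b.norm_op_le

/-- The trace `Tr c = ∑ᵢ ⟨eᵢ, c eᵢ⟩`, computed in the orthonormal basis `e`; for trace class
operators the series converges absolutely and its sum does not depend on `e`. -/
noncomputable def opTrace {ι : Type*} (e : HilbertBasis ι ℂ H) (c : H →L[ℂ] H) : ℂ :=
  ∑' i, inner ℂ (e i) (c (e i))

theorem IsNuclearRep.sum_le {ι : Type*} (e : HilbertBasis ι ℂ H) {b : H →L[ℂ] H} {x y : ℕ → H}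
    (hb : IsNuclearRep b x y) (s : Finset ι) :
    ∑ i ∈ s, ‖inner ℂ (e i) (b (e i))‖ ≤ ∑' n, ‖x n‖ * ‖y n‖ := by
  have hs : ∀ i, HasSum (fun n => inner ℂ (y n) (e i) * inner ℂ (e i) (x n))
      (inner ℂ (e i) (b (e i))) := fun i => by
    simpa [inner_smul_right] using (hb.2 (e i)).mapL (innerSL ℂ (e i))
  have hbound : ∀ n, ∑ i ∈ s, ‖inner ℂ (y n) (e i) * inner ℂ (e i) (x n)‖ ≤ ‖x n‖ * ‖y n‖ := by
    intro n
    have hx := e.orthonormal.sum_inner_products_le (x n) (s := s)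
    have hy := e.orthonormal.sum_inner_products_le (y n) (s := s)
    have hcs := Finset.sum_mul_sq_le_sq_mul_sq s (fun i => ‖inner ℂ (e i) (x n)‖)
      (fun i => ‖inner ℂ (e i) (y n)‖)
    have heq : ∑ i ∈ s, ‖inner ℂ (y n) (e i) * inner ℂ (e i) (x n)‖
        = ∑ i ∈ s, ‖inner ℂ (e i) (x n)‖ * ‖inner ℂ (e i) (y n)‖ := by
      refine Finset.sum_congr rfl fun i _ => ?_
      rw [norm_mul, norm_inner_symm (y n), mul_comm]
    rw [heq]
    refine le_of_sq_le_sq ?_ (by positivity)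
    calc _ ≤ _ := hcs
      _ ≤ ‖x n‖ ^ 2 * ‖y n‖ ^ 2 := mul_le_mul hx hy (by positivity) (by positivity)
      _ = _ := by ring
  have hsm : ∀ i ∈ s, Summable fun n => ‖inner ℂ (y n) (e i) * inner ℂ (e i) (x n)‖ :=
    fun i hi => Summable.of_nonneg_of_le (fun n => norm_nonneg _) (fun n =>
      (Finset.single_le_sum (f := fun i => ‖inner ℂ (y n) (e i) * inner ℂ (e i) (x n)‖)
        (fun j _ => norm_nonneg _) hi).trans (hbound n)) hb.1
  calc ∑ i ∈ s, ‖inner ℂ (e i) (b (e i))‖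
      ≤ ∑ i ∈ s, ∑' n, ‖inner ℂ (y n) (e i) * inner ℂ (e i) (x n)‖ := by
        refine Finset.sum_le_sum fun i hi => ?_
        rw [← (hs i).tsum_eq]
        exact norm_tsum_le_tsum_norm (hsm i hi)
    _ = ∑' n, ∑ i ∈ s, ‖inner ℂ (y n) (e i) * inner ℂ (e i) (x n)‖ :=
        (Summable.tsum_finsetSum hsm).symm
    _ ≤ _ := Summable.tsum_le_tsum hbound (summable_sum hsm) hb.1

theorem IsNuclearRep.summable_trace {ι : Type*} (e : HilbertBasis ι ℂ H) {b : H →L[ℂ] H}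
    {x y : ℕ → H} (hb : IsNuclearRep b x y) : Summable fun i => inner ℂ (e i) (b (e i)) :=
  (summable_of_sum_le (fun _ => norm_nonneg _) (hb.sum_le e)).of_norm

theorem IsNuclearRep.norm_trace_le {ι : Type*} (e : HilbertBasis ι ℂ H) {b : H →L[ℂ] H}
    {x y : ℕ → H} (hb : IsNuclearRep b x y) : ‖opTrace e b‖ ≤ ∑' n, ‖x n‖ * ‖y n‖ := by
  have h := summable_of_sum_le (fun _ => norm_nonneg _) (hb.sum_le e)
  exact (norm_tsum_le_tsum_norm h).trans (h.tsum_le_of_sum_le (hb.sum_le e))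

theorem opTrace_add {ι : Type*} (e : HilbertBasis ι ℂ H) {b c : H →L[ℂ] H}
    (hb : Summable fun i => inner ℂ (e i) (b (e i)))
    (hc : Summable fun i => inner ℂ (e i) (c (e i))) :
    opTrace e (b + c) = opTrace e b + opTrace e c := by
  simp only [opTrace, add_apply, inner_add_right]
  exact hb.tsum_add hc

theorem opTrace_smul {ι : Type*} (e : HilbertBasis ι ℂ H) (z : ℂ) (b : H →L[ℂ] H) :
    opTrace e (z • b) = z * opTrace e b := by
  simp [opTrace, tsum_mul_left]

/-- The conjugation `∑ cᵢ eᵢ ↦ ∑ c̄ᵢ eᵢ` with respect to the orthonormal basis `e`. -/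
noncomputable def basisConj {ι : Type*} (e : HilbertBasis ι ℂ H) : H ≃ₗᵢ⋆[ℂ] H :=
  (e.repr.trans (starₗᵢ ℂ)).trans e.repr.symm

theorem inner_basisConj {ι : Type*} (e : HilbertBasis ι ℂ H) (v w : H) :
    inner ℂ (basisConj e v) w = inner ℂ (basisConj e w) v := by
  have h : ∀ v w, inner ℂ (basisConj e v) w = ∑' i, e.repr v i * e.repr w i := fun v w => by
    rw [← e.repr.inner_map_map, lp.inner_eq_tsum]
    refine tsum_congr fun i => ?_
    simp [basisConj, mul_comm]
  rw [h, h]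
  exact tsum_congr fun i => mul_comm _ _

theorem basisConj_self {ι : Type*} (e : HilbertBasis ι ℂ H) (i : ι) :
    basisConj e (e i) = e i := by
  apply e.repr.injective
  classical
  ext j
  simp [basisConj, HilbertBasis.repr_self, lp.single_apply, Pi.single_apply]

variable [CompleteSpace H]

/-- The transpose `b ↦ bᵗ` with respect to the orthonormal basis `e`. It is given by `J b* J` for
the conjugation `J`; its matrix is the transpose of the matrix of `b`
(see `opTranspose_matrix`). -/
noncomputable def opTranspose {ι : Type*} (e : HilbertBasis ι ℂ H) (b : H →L[ℂ] H) : H →L[ℂ] H :=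
  ((basisConj e : H ≃L⋆[ℂ] H) : H →L⋆[ℂ] H).comp
    ((ContinuousLinearMap.adjoint b).comp ((basisConj e : H ≃L⋆[ℂ] H) : H →L⋆[ℂ] H))

theorem opTranspose_apply {ι : Type*} (e : HilbertBasis ι ℂ H) (b : H →L[ℂ] H) (v : H) :
    opTranspose e b v = basisConj e (ContinuousLinearMap.adjoint b (basisConj e v)) := rfl

theorem opTranspose_matrix {ι : Type*} (e : HilbertBasis ι ℂ H) (b : H →L[ℂ] H) (i j : ι) :
    inner ℂ (e i) (opTranspose e b (e j)) = inner ℂ (e j) (b (e i)) := by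
  rw [opTranspose_apply, basisConj_self, ← inner_conj_symm, inner_basisConj, basisConj_self,
    inner_conj_symm, ContinuousLinearMap.adjoint_inner_left]

theorem opTranspose_add {ι : Type*} (e : HilbertBasis ι ℂ H) (b c : H →L[ℂ] H) :
    opTranspose e (b + c) = opTranspose e b + opTranspose e c := by
  ext v; simp [opTranspose_apply]

theorem opTranspose_smul {ι : Type*} (e : HilbertBasis ι ℂ H) (z : ℂ) (b : H →L[ℂ] H) :
    opTranspose e (z • b) = z • opTranspose e b := by
  ext v
  rw [opTranspose_apply, map_smulₛₗ, ContinuousLinearMap.smul_apply, map_smulₛₗ]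
  simp [opTranspose_apply]

theorem IsNuclearRep.adjoint {b : H →L[ℂ] H} {x y : ℕ → H} (hb : IsNuclearRep b x y) :
    IsNuclearRep (ContinuousLinearMap.adjoint b) y x := by
  refine ⟨by simpa [mul_comm] using hb.1, fun u => ?_⟩
  have hs : Summable fun n => inner ℂ (x n) u • y n := by
    refine Summable.of_norm_bounded (hb.1.mul_right ‖u‖) fun n => ?_
    rw [norm_smul]
    calc _ ≤ (‖x n‖ * ‖u‖) * ‖y n‖ :=
          mul_le_mul_of_nonneg_right (norm_inner_le_norm _ _) (norm_nonneg _)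
      _ = _ := by ring
  convert hs.hasSum using 1
  refine ext_inner_left ℂ fun w => ?_
  have h1 := hs.hasSum.mapL (innerSL ℂ w)
  have h2 := ((hb.2 w).mapL (innerSL ℂ u)).star
  simp only [innerSL_apply_apply, inner_smul_right] at h1 h2
  rw [ContinuousLinearMap.adjoint_inner_right, ← h1.tsum_eq, ← inner_conj_symm]
  refine (h2.tsum_eq.symm.trans (tsum_congr fun n => ?_))
  simp [mul_comm]

theorem IsNuclearRep.transpose {ι : Type*} (e : HilbertBasis ι ℂ H) {b : H →L[ℂ] H}
    {x y : ℕ → H} (hb : IsNuclearRep b x y) :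
    IsNuclearRep (opTranspose e b) (fun n => basisConj e (y n)) (fun n => basisConj e (x n)) := by
  refine ⟨by simpa [mul_comm] using hb.1, fun v => ?_⟩
  have h := (hb.adjoint.2 (basisConj e v)).map (basisConj e) (basisConj e).continuous
  rw [opTranspose_apply]
  convert h using 2 with n
  rw [Function.comp_apply, map_smulₛₗ, inner_conj_symm, inner_basisConj]

/-- The bounded bilinear form `(a, b) ↦ Tr(φ(a) bᵗ)`. -/
noncomputable def dualForm {ι : Type*} (e : HilbertBasis ι ℂ H) {E : Type*}
    [NormedAddCommGroup E] [NormedSpace ℂ E] (φ : E →L[ℂ] (H →L[ℂ] H)) :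
    E →L[ℂ] TraceClass H →L[ℂ] ℂ :=
  LinearMap.mkContinuous₂
    (LinearMap.mk₂ ℂ (fun a b => opTrace e (φ a * opTranspose e (TraceClass.op b)))
      (by
        intro a a' b
        obtain ⟨x, y, h⟩ := b.exists_rep
        have h1 := (h.transpose e).comp_left (φ a)
        have h2 := (h.transpose e).comp_left (φ a')
        rw [map_add, add_mul]
        exact opTrace_add e (h1.summable_trace e) (h2.summable_trace e))
      (by
        intro c a b
        rw [map_smul, smul_mul_assoc]
        exact opTrace_smul e c _)
      (by
        intro a b b'
        obtain ⟨x, y, h⟩ := b.exists_rep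
        obtain ⟨x', y', h'⟩ := b'.exists_rep
        have h1 := (h.transpose e).comp_left (φ a)
        have h2 := (h'.transpose e).comp_left (φ a)
        rw [map_add, opTranspose_add, mul_add]
        exact opTrace_add e (h1.summable_trace e) (h2.summable_trace e))
      (by
        intro c a b
        rw [map_smul, opTranspose_smul, mul_smul_comm]
        exact opTrace_smul e c _))
    ‖φ‖ (by
      intro a b
      have hle : ∀ r ∈ TraceClass.cost b,
          ‖opTrace e (φ a * opTranspose e (TraceClass.op b))‖ ≤ ‖φ a‖ * r := by
        rintro r ⟨x, y, h, rfl⟩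
        have h1 := (h.transpose e).comp_left (φ a)
        refine (h1.norm_trace_le e).trans ?_
        rw [← tsum_mul_left]
        refine h1.1.tsum_le_tsum (fun n => ?_) (h.1.mul_left _)
        have h2 := (φ a).le_opNorm (basisConj e (y n))
        rw [LinearIsometryEquiv.norm_map] at h2 ⊢
        calc _ ≤ (‖φ a‖ * ‖y n‖) * ‖x n‖ := mul_le_mul_of_nonneg_right h2 (norm_nonneg _)
          _ = _ := by ring
      have hmain : ‖opTrace e (φ a * opTranspose e (TraceClass.op b))‖ ≤ ‖φ a‖ * ‖b‖ := by
        rcases eq_or_lt_of_le (norm_nonneg (φ a)) with h0 | h0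
        · obtain ⟨r, hr⟩ := b.cost_nonempty
          have := hle r hr
          rw [← h0, zero_mul] at this ⊢
          exact this
        · rw [← div_le_iff₀' h0]
          exact le_csInf b.cost_nonempty fun r hr => (div_le_iff₀' h0).2 (hle r hr)
      exact hmain.trans (mul_le_mul_of_nonneg_right (φ.le_opNorm a) (norm_nonneg b)))

end TraceClass

/-! ### Operator systems, positive maps and separable functionals -/

/-- An operator system on the Hilbert space `K`: a norm closed, self-adjoint linear space of
bounded operators on `K` that contains the identity. -/
structure OperatorSystem (K : Type*) [NormedAddCommGroup K] [InnerProductSpace ℂ K]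
    [CompleteSpace K] extends Submodule ℂ (K →L[ℂ] K) where
  isClosed' : IsClosed carrier
  star_mem' : ∀ a ∈ carrier, star a ∈ carrier
  one_mem' : (1 : K →L[ℂ] K) ∈ carrier

section Separable

variable {K : Type*} [NormedAddCommGroup K] [InnerProductSpace ℂ K] [CompleteSpace K]
  {H : Type*} [NormedAddCommGroup H] [InnerProductSpace ℂ H] [CompleteSpace H]

/-- The elements of an operator system, with the operator norm. -/
abbrev OperatorSystem.Elem (A : OperatorSystem K) : Type _ := A.toSubmodule

/-- The identity operator as an element of an operator system. -/
def OperatorSystem.one (A : OperatorSystem K) : A.Elem := ⟨1, A.one_mem'⟩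

/-- A bounded linear map `φ : A → B(H)` is positive if it maps positive operators in `A` to
positive operators. -/
def IsPositiveMap {A : OperatorSystem K} (φ : A.Elem →L[ℂ] (H →L[ℂ] H)) : Prop :=
  ∀ a : A.Elem, (a : K →L[ℂ] K).IsPositive → (φ a).IsPositive

/-- A state of an operator system: a positive linear functional `σ` with `σ(1) = 1`. -/
def IsStateOf {A : OperatorSystem K} (σ : A.Elem →L[ℂ] ℂ) : Prop :=
  (∀ a : A.Elem, (a : K →L[ℂ] K).IsPositive → 0 ≤ σ a) ∧ σ A.one = 1

/-- A normal state of `B(H)`: a positive linear functional `ω` with `ω(1) = 1` that is continuous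
in the weak operator topology on bounded sets. -/
def IsNormalState (ω : (H →L[ℂ] H) →L[ℂ] ℂ) : Prop :=
  (∀ b : H →L[ℂ] H, b.IsPositive → 0 ≤ ω b) ∧ ω 1 = 1 ∧
    ∀ r : ℝ, ContinuousOn (fun x : H →WOT[ℂ] H => ω x.toCLM) {x | ‖x.toCLM‖ ≤ r}

/-- The functional `σ ⊗ ω` on `A ⊗̂ T(H)`, with `(σ ⊗ ω)(a ⊗ b) = σ(a) ω(b)`. -/
noncomputable def productFunctional {A : OperatorSystem K} (σ : A.Elem →L[ℂ] ℂ)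
    (ω : (H →L[ℂ] H) →L[ℂ] ℂ) : WeakDual ℂ (ProjTensor A.Elem (TraceClass H)) :=
  StrongDual.toWeakDual (ProjTensor.lift (σ.smulRight (ω.comp TraceClass.op)))

variable (H) in
/-- The finite positive sums `∑ cᵢ σᵢ ⊗ ωᵢ`, with `cᵢ ≥ 0`, `σᵢ` states of `A` and `ωᵢ` normal
states of `B(H)`. -/
def productCone (A : OperatorSystem K) : Set (WeakDual ℂ (ProjTensor A.Elem (TraceClass H))) :=
  {ρ | ∃ (n : ℕ) (c : Fin n → ℝ) (σ : Fin n → (A.Elem →L[ℂ] ℂ))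
    (ω : Fin n → ((H →L[ℂ] H) →L[ℂ] ℂ)),
    (∀ i, 0 ≤ c i) ∧ (∀ i, IsStateOf (σ i)) ∧ (∀ i, IsNormalState (ω i)) ∧
      ρ = ∑ i, (c i : ℂ) • productFunctional (σ i) (ω i)}

variable (H) in
/-- The cone `S(A, H)` of separable functionals: the closure of the finite positive sums of
products of states, in the weak-* topology of the dual of `A ⊗̂ T(H)`. -/
def separableCone (A : OperatorSystem K) :
    Set (WeakDual ℂ (ProjTensor A.Elem (TraceClass H))) :=
  closure (productCone H A)

/-- The functional `φ̃` on `A ⊗̂ T(H)` that is dual to a bounded linear map `φ : A → B(H)`; it is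
determined by `φ̃(a ⊗ b) = Tr(φ(a) bᵗ)` (see `tilde_tmul`). -/
noncomputable def tilde {ι : Type*} (e : HilbertBasis ι ℂ H) {A : OperatorSystem K}
    (φ : A.Elem →L[ℂ] (H →L[ℂ] H)) : WeakDual ℂ (ProjTensor A.Elem (TraceClass H)) :=
  StrongDual.toWeakDual (ProjTensor.lift (dualForm e φ))

theorem tilde_tmul {ι : Type*} (e : HilbertBasis ι ℂ H) {A : OperatorSystem K}
    (φ : A.Elem →L[ℂ] (H →L[ℂ] H)) (a : A.Elem) (b : TraceClass H) :
    tilde e φ (ProjTensor.tmul a b) = opTrace e (φ a * opTranspose e (TraceClass.op b)) :=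
  ProjTensor.lift_tmul (dualForm e φ) a b

theorem productFunctional_tmul {A : OperatorSystem K} (σ : A.Elem →L[ℂ] ℂ)
    (ω : (H →L[ℂ] H) →L[ℂ] ℂ) (a : A.Elem) (b : TraceClass H) :
    productFunctional σ ω (ProjTensor.tmul a b) = σ a * ω (TraceClass.op b) :=
  ProjTensor.lift_tmul (σ.smulRight (ω.comp TraceClass.op)) a b

end Separable

/-! A positive map into a commutative C⋆-algebra is a point-norm limit of maps `a ↦ ∑ σᵢ(a) Tᵢ` with
`σᵢ` positive functionals and `Tᵢ` positive operators. The range of `φ` lies in the double commutant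
`W` of `C`, a unital commutative C⋆-algebra, so `W` is some `C(X)` by Gelfand duality. Given
finitely many `a`, a partition of unity `hᵢ` subordinate to a fine enough cover of `X` gives `φ(a) ≈
∑ χᵢ(φ(a)) hᵢ`, where the `χᵢ` are characters; each `χᵢ ∘ φ` is positive, and the approximants are
bounded by `‖φ‖` (`exists_separable_approx`).

Such a map has dual functional `∑ σᵢ ⊗ Tr(Tᵢ bᵗ)`. As `Tᵢ` need not be trace class, `b ↦ Tr(Tᵢ bᵗ)`
need not extend to a normal functional on `B(H)`. Its truncations `∑ Tᵢⱼ bᵢⱼ` over finite index sets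
do; they are positive by the Schur product theorem (`finTraceForm_nonneg`) and converge on `T(H)`
(`tendsto_finTraceForm`). Both limits become weak-* limits because all forms involved are uniformly
bounded (`ProjTensor.tendsto_lift`). -/

/-! ### Functionals on the projective tensor product -/

theorem ProjTensor.norm_lift_apply_le {E F : Type*} [NormedAddCommGroup E] [NormedSpace ℂ E]
    [NormedAddCommGroup F] [NormedSpace ℂ F] (B : E →L[ℂ] F →L[ℂ] ℂ) (z : ProjTensor E F) :
    ‖ProjTensor.lift B z‖ ≤ ‖B‖ * ‖z‖ := by
  refine Completion.induction_on z ?_ fun a => ?_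
  · exact isClosed_le (by fun_prop) (by fun_prop)
  · rw [Completion.norm_coe]
    have h := ContinuousLinearMap.extend_eq
      ((AlgProj.liftₗ B).mkContinuous ‖B‖ (AlgProj.norm_liftₗ_le B))
      (e := (Completion.toComplL : AlgProj E F →L[ℂ] Completion (AlgProj E F)))
      Completion.denseRange_coe (Completion.isUniformInducing_coe _) a
    exact (congrArg norm h).trans_le (AlgProj.norm_liftₗ_le B a)

theorem ProjTensor.induction {E F : Type*} [NormedAddCommGroup E] [NormedSpace ℂ E]
    [NormedAddCommGroup F] [NormedSpace ℂ F] {p : ProjTensor E F → Prop}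
    (hp : IsClosed {z | p z}) (h0 : p 0) (htmul : ∀ a b, p (ProjTensor.tmul a b))
    (hadd : ∀ x y, p x → p y → p (x + y)) (z : ProjTensor E F) : p z := by
  refine Completion.induction_on z hp fun a => ?_
  obtain ⟨l, rfl⟩ := AlgProj.exists_list a
  induction l with
  | nil => exact h0
  | cons q l ih =>
    rw [List.map_cons, List.sum_cons, Completion.coe_add]
    exact hadd _ _ (htmul _ _) ih

theorem ProjTensor.dual_ext {E F : Type*} [NormedAddCommGroup E] [NormedSpace ℂ E]
    [NormedAddCommGroup F] [NormedSpace ℂ F] {f g : WeakDual ℂ (ProjTensor E F)}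
    (h : ∀ a b, f (ProjTensor.tmul a b) = g (ProjTensor.tmul a b)) : f = g := by
  refine DFunLike.ext _ _ fun z => ?_
  refine ProjTensor.induction (p := fun z => f z = g z) (isClosed_eq ?_ ?_) (by simp) h ?_ z
  · exact (WeakDual.toStrongDual f).continuous
  · exact (WeakDual.toStrongDual g).continuous
  · intro x y hx hy
    simp only [map_add, hx, hy]

-- The uniform bound `M` makes the set of points of convergence closed, and elementary tensors have
-- dense span.
open Filter Topology in
theorem ProjTensor.tendsto_lift {E F : Type*} [NormedAddCommGroup E] [NormedSpace ℂ E]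
    [NormedAddCommGroup F] [NormedSpace ℂ F] {κ : Type*} {l : Filter κ}
    {B' : κ → E →L[ℂ] F →L[ℂ] ℂ} {B : E →L[ℂ] F →L[ℂ] ℂ} {M : ℝ} (hM : ∀ k, ‖B' k‖ ≤ M)
    (h : ∀ a b, Tendsto (fun k => B' k a b) l (𝓝 (B a b))) :
    Tendsto (fun k => StrongDual.toWeakDual (ProjTensor.lift (B' k))) l
      (𝓝 (StrongDual.toWeakDual (ProjTensor.lift B))) := by
  rw [tendsto_iff_forall_eval_tendsto_topDualPairing]
  intro z
  change Tendsto (fun k => ProjTensor.lift (B' k) z) l (𝓝 (ProjTensor.lift B z))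
  refine ProjTensor.induction
    (p := fun z => Tendsto (fun k => ProjTensor.lift (B' k) z) l (𝓝 (ProjTensor.lift B z)))
    ?_ (by simp [tendsto_const_nhds]) (fun a b => by simpa using h a b) ?_ z
  · refine isClosed_of_closure_subset fun z hz => ?_
    set N := max M ‖B‖ with hN
    have hN0 : 0 ≤ N := (norm_nonneg B).trans (le_max_right _ _)
    rw [Set.mem_ofPred_eq, Metric.tendsto_nhds]
    intro ε hε
    -- `N` bounds every `‖B' k‖` and `‖B‖`, so moving from `z` to `w` costs less than `ε / 3` on
    -- each side; the `+ 1` keeps the denominator positive.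
    obtain ⟨w, hw, hzw⟩ := Metric.mem_closure_iff.1 hz (ε / (3 * (N + 1))) (by positivity)
    rw [dist_eq_norm, lt_div_iff₀ (by positivity)] at hzw
    filter_upwards [(Metric.tendsto_nhds.1 hw) (ε / 3) (by positivity)] with k hk
    rw [dist_eq_norm] at hk ⊢
    have h1 := ProjTensor.norm_lift_apply_le (B' k) (z - w)
    have h2 := ProjTensor.norm_lift_apply_le B (z - w)
    have h3 := mul_le_mul_of_nonneg_right ((hM k).trans (le_max_left M ‖B‖)) (norm_nonneg (z - w))
    have h4 := mul_le_mul_of_nonneg_right (le_max_right M ‖B‖) (norm_nonneg (z - w))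
    rw [← hN] at h3 h4
    have h5 : ProjTensor.lift (B' k) z - ProjTensor.lift B z
        = ProjTensor.lift (B' k) (z - w) + (ProjTensor.lift (B' k) w - ProjTensor.lift B w)
          - ProjTensor.lift B (z - w) := by
      simp only [map_sub]; ring
    rw [h5]
    have h6 := norm_sub_le (ProjTensor.lift (B' k) (z - w)
      + (ProjTensor.lift (B' k) w - ProjTensor.lift B w)) (ProjTensor.lift B (z - w))
    have h7 := norm_add_le (ProjTensor.lift (B' k) (z - w))
      (ProjTensor.lift (B' k) w - ProjTensor.lift B w)
    nlinarith [norm_nonneg (z - w)]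
  · intro x y hx hy
    simp only [map_add]
    exact hx.add hy

/-! ### Partitions of unity in commutative C⋆-algebras -/

/-- On the cover by sets where each `f ∈ F` stays within `ε` of its value at the centre, the error
at `x` is a convex combination of the differences `f x - f i`, and only those `i` whose set contains
`x` contribute. -/
theorem ContinuousMap.exists_partition_approx {X : Type*} [TopologicalSpace X] [CompactSpace X]
    [T2Space X] (F : Finset C(X, ℂ)) {ε : ℝ} (hε : 0 < ε) :
    ∃ (t : Finset X) (h : t → C(X, ℝ)), (∀ i x, 0 ≤ h i x) ∧ (∀ x, ∑ i, h i x = 1) ∧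
      ∀ f ∈ F, ∀ x, ‖f x - ∑ i : t, f i * h i x‖ ≤ ε := by
  let U : X → Set X := fun x => {y | ∀ f ∈ F, ‖f y - f x‖ < ε}
  have hUo : ∀ x, IsOpen (U x) := fun x => by
    have : U x = ⋂ f ∈ F, {y | ‖f y - f x‖ < ε} := by ext; simp [U]
    rw [this]
    exact isOpen_biInter_finset fun f _ => isOpen_lt (by fun_prop) (by fun_prop)
  obtain ⟨t, ht⟩ := isCompact_univ.elim_finite_subcover U hUo
    fun x _ => Set.mem_iUnion.2 ⟨x, fun f _ => by simpa using hε⟩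
  obtain ⟨p, hp⟩ := PartitionOfUnity.exists_isSubordinate isClosed_univ
    (fun i : t => U i) (fun i => hUo i) (by simpa [Set.iUnion_subtype] using ht)
  have hsum : ∀ x, ∑ i, p i x = 1 := fun x => by
    rw [← finsum_eq_sum_of_fintype]
    exact p.sum_eq_one (Set.mem_univ x)
  refine ⟨t, fun i => p i, fun i x => p.nonneg i x, hsum, fun f hf x => ?_⟩
  have h1 : f x - ∑ i : t, f i * p i x = ∑ i : t, (f x - f i) * (p i x : ℂ) := by
    simp only [sub_mul, Finset.sum_sub_distrib]
    rw [← Finset.mul_sum, ← Complex.ofReal_sum, hsum, Complex.ofReal_one, mul_one]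
  rw [h1]
  calc _ ≤ ∑ i, ε * p i x := by
        refine norm_sum_le_of_le _ fun i _ => ?_
        rw [norm_mul, Complex.norm_real, Real.norm_of_nonneg (p.nonneg i x)]
        by_cases hx : p i x = 0
        · simp [hx]
        · exact mul_le_mul_of_nonneg_right
            (hp i (subset_tsupport _ (Function.mem_support.2 hx)) f hf).le (p.nonneg i x)
    _ = ε := by rw [← Finset.mul_sum, hsum, mul_one]

-- The Gelfand transform turns point evaluations into characters. Writing the partition functions as
-- `star (g i) * g i` keeps them visibly positive under any star homomorphism; the contraction bound
-- later supplies the uniform bound on the approximants.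
open WeakDual in
theorem CommCStarAlgebra.exists_partition_approx {R : Type*} [CommCStarAlgebra R] (F : Finset R)
    {ε : ℝ} (hε : 0 < ε) :
    ∃ (t : Finset (characterSpace ℂ R)) (g : t → R),
      (∀ x, ‖∑ i : t, (i : characterSpace ℂ R) x • (star (g i) * g i)‖ ≤ ‖x‖) ∧
      ∀ x ∈ F, ‖x - ∑ i : t, (i : characterSpace ℂ R) x • (star (g i) * g i)‖ ≤ ε := by
  classical
  let Γ := gelfandStarTransform R
  have hΓ : ∀ x, ‖Γ x‖ = ‖x‖ := fun x =>
    (gelfandTransform_isometry R).norm_map_of_map_zero (map_zero _) x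
  obtain ⟨t, h, h0, h1, h2⟩ := ContinuousMap.exists_partition_approx (F.image Γ) hε
  let r : t → C(characterSpace ℂ R, ℂ) := fun i =>
    ⟨fun x => (Real.sqrt (h i x) : ℂ), by fun_prop⟩
  let g : t → R := fun i => Γ.symm (r i)
  have key : ∀ x y, Γ (∑ i : t, (i : characterSpace ℂ R) x • (star (g i) * g i)) y
      = ∑ i : t, Γ x i * h i y := fun x y => by
    rw [map_sum, ContinuousMap.sum_apply]
    refine Finset.sum_congr rfl fun i _ => ?_
    rw [map_smul, map_mul, map_star, StarAlgEquiv.apply_symm_apply]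
    simp only [ContinuousMap.smul_apply, ContinuousMap.mul_apply, ContinuousMap.star_apply,
      smul_eq_mul, r, ContinuousMap.coe_mk, RCLike.star_def, Complex.conj_ofReal]
    rw [← Complex.ofReal_mul, Real.mul_self_sqrt (h0 i y)]
    rfl
  refine ⟨t, g, fun x => ?_, fun x hx => ?_⟩
  · rw [← hΓ, ContinuousMap.norm_le _ (norm_nonneg _)]
    intro y
    rw [key]
    calc _ ≤ ∑ i, ‖x‖ * h i y := by
          refine norm_sum_le_of_le _ fun i _ => ?_
          rw [norm_mul, Complex.norm_real, Real.norm_of_nonneg (h0 i y), ← hΓ x]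
          exact mul_le_mul_of_nonneg_right (ContinuousMap.norm_coe_le_norm _ _) (h0 i y)
      _ = ‖x‖ := by rw [← Finset.mul_sum, h1, mul_one]
  · rw [← hΓ, ContinuousMap.norm_le _ hε.le]
    intro y
    rw [map_sub, ContinuousMap.sub_apply, key]
    exact h2 _ (Finset.mem_image_of_mem _ hx) y

/-! ### Finite truncations of the trace pairing -/

/-- The orthogonal projection onto the span of finitely many vectors of a Hilbert basis. -/
noncomputable def HilbertBasis.finProj {ι H : Type*} [NormedAddCommGroup H] [InnerProductSpace ℂ H]
    (e : HilbertBasis ι ℂ H) (s : Finset ι) : H →L[ℂ] H :=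
  ∑ i ∈ s, InnerProductSpace.rankOne ℂ (e i) (e i)

section

variable {ι H : Type*} [NormedAddCommGroup H] [InnerProductSpace ℂ H] (e : HilbertBasis ι ℂ H)

theorem HilbertBasis.finProj_apply (s : Finset ι) (v : H) :
    e.finProj s v = ∑ i ∈ s, inner ℂ (e i) v • e i := by
  simp [HilbertBasis.finProj]

theorem HilbertBasis.norm_finProj_apply_le (s : Finset ι) (v : H) :
    ‖e.finProj s v‖ ≤ ‖v‖ := by
  -- `⟨Pv, Pv⟩ = ⟨Pv, v⟩` for the projection `P`; Cauchy–Schwarz then gives `‖Pv‖² ≤ ‖Pv‖ ‖v‖`.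
  have h : inner ℂ (e.finProj s v) (e.finProj s v) = inner ℂ (e.finProj s v) v := by
    rw [e.finProj_apply, e.orthonormal.inner_sum, sum_inner]
    exact Finset.sum_congr rfl fun i _ => by rw [inner_smul_left]
  have h2 : ‖e.finProj s v‖ * ‖e.finProj s v‖ ≤ ‖e.finProj s v‖ * ‖v‖ := by
    have := norm_inner_le_norm (𝕜 := ℂ) (e.finProj s v) v
    rwa [← h, inner_self_eq_norm_sq_to_K, ← RCLike.ofReal_pow, RCLike.norm_ofReal, abs_sq, sq] at this
  rcases (norm_nonneg (e.finProj s v)).eq_or_lt with h0 | h0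
  · rw [← h0]; exact norm_nonneg v
  · exact le_of_mul_le_mul_left h2 h0

theorem HilbertBasis.norm_finProj_le (s : Finset ι) : ‖e.finProj s‖ ≤ 1 :=
  ContinuousLinearMap.opNorm_le_bound _ zero_le_one fun v => by
    simpa using e.norm_finProj_apply_le s v

open Filter Topology in
theorem HilbertBasis.tendsto_finProj (v : H) :
    Tendsto (fun s => e.finProj s v) atTop (𝓝 v) := by
  simp only [e.finProj_apply, ← e.repr_apply_apply]
  exact e.hasSum_repr v

open Filter Topology in
/-- The trace of `∑ₙ ⟨yₙ, ·⟩ xₙ` is `∑ₙ ⟨yₙ, xₙ⟩`. -/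
theorem IsNuclearRep.opTrace_eq {b : H →L[ℂ] H} {x y : ℕ → H} (hb : IsNuclearRep b x y) :
    opTrace e b = ∑' n, inner ℂ (y n) (x n) := by
  refine tendsto_nhds_unique (hb.summable_trace e).hasSum ?_
  -- A partial sum of the trace inserts the projection onto the span of `s` in the nuclear series;
  -- dominated convergence, with bound `‖xₙ‖ ‖yₙ‖`, removes it as `s` grows.
  have h : ∀ s : Finset ι, ∑ i ∈ s, inner ℂ (e i) (b (e i))
      = ∑' n, inner ℂ (y n) (e.finProj s (x n)) := fun s => by
    refine (HasSum.tsum_eq ?_).symm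
    have := hasSum_sum (s := s) fun i _ => (hb.2 (e i)).mapL (innerSL ℂ (e i))
    simpa [e.finProj_apply, inner_sum, inner_smul_right, mul_comm] using this
  simp only [SummationFilter.unconditional_filter, h]
  refine tendsto_tsum_of_dominated_convergence hb.1 (fun n => ?_)
    (Eventually.of_forall fun s n => ?_)
  · exact tendsto_const_nhds.inner (e.tendsto_finProj (x n))
  · rw [mul_comm]
    exact (norm_inner_le_norm _ _).trans
      (mul_le_mul_of_nonneg_left (e.norm_finProj_apply_le s _) (norm_nonneg _))

variable [CompleteSpace H]

/-- The bounded bilinear form `(T, b) ↦ Tr(T bᵗ)`. -/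
noncomputable def traceForm : (H →L[ℂ] H) →L[ℂ] TraceClass H →L[ℂ] ℂ :=
  dualForm e (ContinuousLinearMap.id ℂ (H →L[ℂ] H))

theorem dualForm_eq {E : Type*} [NormedAddCommGroup E] [NormedSpace ℂ E]
    (φ : E →L[ℂ] (H →L[ℂ] H)) : dualForm e φ = (traceForm e).comp φ := rfl

theorem traceForm_eq_tsum (T : H →L[ℂ] H) {b : TraceClass H} {x y : ℕ → H}
    (hb : IsNuclearRep (TraceClass.opₗ b) x y) :
    traceForm e T b = ∑' n, inner ℂ (basisConj e (x n)) (T (basisConj e (y n))) :=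
  ((hb.transpose e).comp_left T).opTrace_eq e

/-- The functional `b ↦ ∑ Tᵢⱼ bᵢⱼ` on `B(H)`, with the sum over a finite set of indices. -/
noncomputable def finTraceForm (s : Finset ι) (T : H →L[ℂ] H) : (H →L[ℂ] H) →L[ℂ] ℂ :=
  ∑ i ∈ s, ∑ j ∈ s, inner ℂ (e i) (T (e j)) •
    (innerSL ℂ (e i)).comp (ContinuousLinearMap.apply ℂ H (e j))

omit [CompleteSpace H] in
theorem finTraceForm_apply (s : Finset ι) (T b : H →L[ℂ] H) :
    finTraceForm e s T b
      = ∑ i ∈ s, ∑ j ∈ s, inner ℂ (e i) (T (e j)) * inner ℂ (e i) (b (e j)) := by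
  simp [finTraceForm]

omit [CompleteSpace H] in
theorem inner_basisConj_basis (i : ι) (v : H) :
    inner ℂ (basisConj e v) (e i) = inner ℂ (e i) v := by
  rw [inner_basisConj, basisConj_self]

/-- Truncating the sum amounts to compressing `T` by the projection `P` of `s`; both the limit and
the bound uniform in `s` are read off from `P T P`. -/
theorem finTraceForm_op (s : Finset ι) (T : H →L[ℂ] H) (b : TraceClass H) :
    finTraceForm e s T (TraceClass.op b)
      = traceForm e (e.finProj s * T * e.finProj s) b := by
  obtain ⟨x, y, h⟩ := b.exists_rep
  rw [traceForm_eq_tsum e _ h, finTraceForm_apply]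
  refine (HasSum.tsum_eq ?_).symm
  have h1 := hasSum_sum (s := s) fun i _ => hasSum_sum (s := s) fun j _ =>
    ((h.2 (e j)).mapL (innerSL ℂ (e i))).mul_left (inner ℂ (e i) (T (e j)))
  convert! h1 using 1
  funext n
  have hy : ∀ j, inner ℂ (e j) (basisConj e (y n)) = inner ℂ (y n) (e j) := fun j => by
    rw [← inner_conj_symm, inner_basisConj_basis, inner_conj_symm]
  simp only [ContinuousLinearMap.mul_def, ContinuousLinearMap.comp_apply, e.finProj_apply, map_sum, map_smul, inner_sum,
    inner_smul_right, inner_basisConj_basis, hy, innerSL_apply_apply, Finset.mul_sum,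
    smul_eq_mul]
  rw [Finset.sum_comm]
  exact Finset.sum_congr rfl fun i _ => Finset.sum_congr rfl fun j _ => by ring

-- The projections are self-adjoint and tend strongly to the identity, so each term of the nuclear
-- series converges, dominated by `‖T‖ ‖xₙ‖ ‖yₙ‖`.
open Filter Topology in
theorem tendsto_finTraceForm (T : H →L[ℂ] H) (b : TraceClass H) :
    Tendsto (fun s => finTraceForm e s T (TraceClass.op b)) atTop (𝓝 (traceForm e T b)) := by
  obtain ⟨x, y, h⟩ := b.exists_rep
  simp only [finTraceForm_op, traceForm_eq_tsum e _ h]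
  refine tendsto_tsum_of_dominated_convergence (h.1.mul_left ‖T‖) (fun n => ?_)
    (Eventually.of_forall fun s n => ?_)
  · have hsa : ∀ s v w, inner ℂ v (e.finProj s w) = inner ℂ (e.finProj s v) w := fun s v w => by
      simp [e.finProj_apply, mul_comm]
    simp only [ContinuousLinearMap.mul_def, ContinuousLinearMap.comp_apply, hsa]
    exact (e.tendsto_finProj _).inner ((T.continuous.tendsto _).comp (e.tendsto_finProj _))
  · refine (norm_inner_le_norm _ _).trans ?_
    have h1 := e.norm_finProj_apply_le s (T (e.finProj s (basisConj e (y n))))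
    have h2 := T.le_opNorm (e.finProj s (basisConj e (y n)))
    have h3 := mul_le_mul_of_nonneg_left (e.norm_finProj_apply_le s (basisConj e (y n)))
      (norm_nonneg T)
    rw [LinearIsometryEquiv.norm_map] at h3 ⊢
    calc _ ≤ ‖x n‖ * (‖T‖ * ‖y n‖) :=
          mul_le_mul_of_nonneg_left (h1.trans (h2.trans h3)) (norm_nonneg _)
      _ = _ := by ring

theorem norm_finTraceForm_comp_op_le (s : Finset ι) (T : H →L[ℂ] H) :
    ‖(finTraceForm e s T).comp TraceClass.op‖ ≤ ‖traceForm e‖ * ‖T‖ := by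
  have h : (finTraceForm e s T).comp TraceClass.op
      = traceForm e (e.finProj s * T * e.finProj s) := by
    ext b; exact finTraceForm_op e s T b
  rw [h]
  refine ((traceForm e).le_opNorm _).trans (mul_le_mul_of_nonneg_left ?_ (norm_nonneg _))
  have hP := e.norm_finProj_le s
  calc _ ≤ ‖e.finProj s * T‖ * ‖e.finProj s‖ := norm_mul_le _ _
    _ ≤ (‖e.finProj s‖ * ‖T‖) * ‖e.finProj s‖ := by gcongr; exact norm_mul_le _ _
    _ ≤ (1 * ‖T‖) * 1 := by gcongr
    _ = ‖T‖ := by ring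

/-- With `T = g* g` this is the Gram matrix of the vectors `g (v i)`. -/
theorem ContinuousLinearMap.IsPositive.posSemidef_matrix {κ : Type*} [Finite κ] {T : H →L[ℂ] H}
    (hT : T.IsPositive) (v : κ → H) :
    (Matrix.of fun i j => inner ℂ (v i) (T (v j))).PosSemidef := by
  rw [← ContinuousLinearMap.nonneg_iff_isPositive] at hT
  obtain ⟨g, rfl⟩ := CStarAlgebra.nonneg_iff_eq_star_mul_self.1 hT
  have h : (Matrix.of fun i j => inner ℂ (v i) ((star g * g) (v j)))
      = Matrix.gram ℂ fun i => g (v i) := by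
    ext i j
    simp [Matrix.gram, ContinuousLinearMap.star_eq_adjoint, ContinuousLinearMap.adjoint_inner_right]
  rw [h]
  exact Matrix.posSemidef_gram ℂ _

/-- Schur product theorem: the value is the quadratic form of the Hadamard product of two positive
semidefinite matrices at the all-ones vector. -/
theorem finTraceForm_nonneg (s : Finset ι) {T b : H →L[ℂ] H} (hT : T.IsPositive)
    (hb : b.IsPositive) : 0 ≤ finTraceForm e s T b := by
  have h := ((hT.posSemidef_matrix fun i : s => e i).hadamard
    (hb.posSemidef_matrix fun i : s => e i)).dotProduct_mulVec_nonneg 1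
  rw [finTraceForm_apply, ← Finset.sum_coe_sort]
  convert h using 1
  simp only [dotProduct, Matrix.mulVec, Matrix.hadamard_apply, Matrix.of_apply, star_one,
    Pi.one_apply, one_mul, mul_one]
  exact Finset.sum_congr rfl fun i _ => (Finset.sum_coe_sort _ _).symm

theorem continuous_finTraceForm_wot (s : Finset ι) (T : H →L[ℂ] H) :
    Continuous fun x : H →WOT[ℂ] H => finTraceForm e s T x.toCLM := by
  simp only [finTraceForm_apply]
  refine continuous_finsetSum _ fun i _ => continuous_finsetSum _ fun j _ =>
    continuous_const.mul ?_
  exact ContinuousLinearMapWOT.continuous_inner_apply continuous_id _ _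

end

/-! ### Positive functionals, the product cone and the double commutant -/

section

variable {K : Type*} [NormedAddCommGroup K] [InnerProductSpace ℂ K] [CompleteSpace K]
  {H : Type*} [NormedAddCommGroup H] [InnerProductSpace ℂ H] [CompleteSpace H]

/-- A positive functional on an operator system that vanishes at the identity is zero. -/
theorem OperatorSystem.eq_zero_of_apply_one {A : OperatorSystem K} {σ : A.Elem →L[ℂ] ℂ}
    (hσ : ∀ a : A.Elem, (a : K →L[ℂ] K).IsPositive → 0 ≤ σ a) (h1 : σ A.one = 0) : σ = 0 := by
  have hsa : ∀ a : A.Elem, IsSelfAdjoint (a : K →L[ℂ] K) → σ a = 0 := by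
    intro a ha
    -- `‖b‖ · 1 - b` is positive and `σ` vanishes at the identity, so `σ b ≤ 0`; applying this to
    -- `-a` gives the reverse inequality.
    have hle : ∀ b : A.Elem, IsSelfAdjoint (b : K →L[ℂ] K) → σ b ≤ 0 := fun b hb => by
      have hb' := hb.le_algebraMap_norm_self
      rw [← sub_nonneg, ContinuousLinearMap.nonneg_iff_isPositive] at hb'
      have h := hσ ((‖(b : K →L[ℂ] K)‖ : ℂ) • A.one - b) (by
        convert hb' using 1
        simp [Algebra.algebraMap_eq_smul_one, OperatorSystem.one])
      rw [map_sub, map_smul, h1, smul_zero, zero_sub] at h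
      exact neg_nonneg.1 h
    refine le_antisymm (hle a ha) ?_
    have h := hle (-a) ha.neg
    rw [map_neg] at h
    exact neg_nonpos.1 h
  refine ContinuousLinearMap.ext fun a => ?_
  -- `a + a*` and `i(a - a*)` are self-adjoint, and together they determine `2a`.
  let a' : A.Elem := ⟨star (a : K →L[ℂ] K), A.star_mem' _ a.2⟩
  have hre := hsa (a + a') (IsSelfAdjoint.add_star_self (a : K →L[ℂ] K))
  have him := hsa (Complex.I • (a - a')) (by
    simp [a', IsSelfAdjoint, star_smul, ← smul_neg])
  rw [map_add] at hre
  rw [map_smul, map_sub, smul_eq_mul, mul_eq_zero, or_iff_right Complex.I_ne_zero] at him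
  have : 2 * σ a = 0 := by linear_combination hre + him
  simpa using this

/-- All bounded operators, as an operator system. -/
def OperatorSystem.univ : OperatorSystem K where
  toSubmodule := ⊤
  isClosed' := isClosed_univ
  star_mem' _ _ := trivial
  one_mem' := trivial

theorem eq_zero_of_positive_of_apply_one {ω : (H →L[ℂ] H) →L[ℂ] ℂ}
    (hω : ∀ b : H →L[ℂ] H, b.IsPositive → 0 ≤ ω b) (h1 : ω 1 = 0) : ω = 0 := by
  have h := OperatorSystem.eq_zero_of_apply_one (A := OperatorSystem.univ)
    (σ := ω.comp (⊤ : Submodule ℂ (H →L[ℂ] H)).subtypeL) (fun a ha => hω _ ha) h1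
  ext b
  exact DFunLike.congr_fun h ⟨b, trivial⟩

/-- The product of a positive functional on `A` with a positive normal functional on `B(H)`, not
necessarily normalised, lies in the product cone. -/
theorem productFunctional_mem_productCone {A : OperatorSystem K} {σ : A.Elem →L[ℂ] ℂ}
    (hσ : ∀ a : A.Elem, (a : K →L[ℂ] K).IsPositive → 0 ≤ σ a) {ω : (H →L[ℂ] H) →L[ℂ] ℂ}
    (hω : ∀ b : H →L[ℂ] H, b.IsPositive → 0 ≤ ω b)
    (hc : Continuous fun x : H →WOT[ℂ] H => ω x.toCLM) :
    productFunctional σ ω ∈ productCone H A := by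
  -- If a factor vanishes at the identity it is zero and the empty sum serves; otherwise both
  -- factors are divided by their values there, and the product of these values is the coefficient.
  by_cases h0 : σ A.one = 0 ∨ ω 1 = 0
  · refine ⟨0, Fin.elim0, Fin.elim0, Fin.elim0, nofun, nofun, nofun, ?_⟩
    refine ProjTensor.dual_ext fun a b => ?_
    rw [productFunctional_tmul]
    rcases h0 with h0 | h0
    · simp [OperatorSystem.eq_zero_of_apply_one hσ h0]
      rfl
    · simp [eq_zero_of_positive_of_apply_one hω h0]
      rfl
  · rw [not_or] at h0
    have hr : 0 ≤ σ A.one := hσ _ ContinuousLinearMap.isPositive_one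
    have hs : 0 ≤ ω 1 := hω _ ContinuousLinearMap.isPositive_one
    have hrs := mul_nonneg hr hs
    refine ⟨1, fun _ => (σ A.one * ω 1).re, fun _ => (σ A.one)⁻¹ • σ, fun _ => (ω 1)⁻¹ • ω,
      fun _ => (Complex.nonneg_iff.1 hrs).1, fun _ => ⟨fun a ha => ?_, ?_⟩,
      fun _ => ⟨fun b hb => ?_, ?_, fun r => ?_⟩, ?_⟩
    · exact mul_nonneg (inv_nonneg.2 hr) (hσ a ha)
    · exact inv_mul_cancel₀ h0.1
    · exact mul_nonneg (inv_nonneg.2 hs) (hω b hb)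
    · exact inv_mul_cancel₀ h0.2
    · exact (continuous_const.mul hc).continuousOn
    · have hre : (((σ A.one * ω 1).re : ℝ) : ℂ) = σ A.one * ω 1 :=
        (Complex.eq_re_of_ofReal_le (r := 0) (by simpa using hrs)).symm
      refine ProjTensor.dual_ext fun a b => ?_
      rw [Fin.sum_univ_one, hre]
      change _ = (σ A.one * ω 1) * productFunctional ((σ A.one)⁻¹ • σ) ((ω 1)⁻¹ • ω) _
      rw [productFunctional_tmul, productFunctional_tmul]
      simp only [smul_apply, smul_eq_mul]
      field_simp [h0.1, h0.2]

omit [CompleteSpace H] in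
theorem zero_mem_productCone (A : OperatorSystem K) : 0 ∈ productCone H A :=
  ⟨0, Fin.elim0, Fin.elim0, Fin.elim0, nofun, nofun, nofun, by simp⟩

omit [CompleteSpace H] in
theorem add_mem_productCone {A : OperatorSystem K}
    {ρ ρ' : WeakDual ℂ (ProjTensor A.Elem (TraceClass H))} (h : ρ ∈ productCone H A)
    (h' : ρ' ∈ productCone H A) : ρ + ρ' ∈ productCone H A := by
  obtain ⟨n, c, σ, ω, hc, hσ, hω, rfl⟩ := h
  obtain ⟨n', c', σ', ω', hc', hσ', hω', rfl⟩ := h'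
  refine ⟨n + n', Fin.append c c', Fin.append σ σ', Fin.append ω ω', ?_, ?_, ?_, ?_⟩
  · exact fun i => Fin.addCases (by simpa using hc) (by simpa using hc') i
  · exact fun i => Fin.addCases (by simpa using hσ) (by simpa using hσ') i
  · exact fun i => Fin.addCases (by simpa using hω) (by simpa using hω') i
  · simp [Fin.sum_univ_add]

omit [CompleteSpace H] in
theorem sum_mem_separableCone {A : OperatorSystem K} {κ : Type*} (t : Finset κ)
    {ρ : κ → WeakDual ℂ (ProjTensor A.Elem (TraceClass H))}
    (h : ∀ i ∈ t, ρ i ∈ separableCone H A) : ∑ i ∈ t, ρ i ∈ separableCone H A :=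
  Finset.sum_induction ρ (· ∈ separableCone H A)
    (fun _ _ ha hb => map_mem_closure₂ continuous_add ha hb fun _ h1 _ h2 =>
      add_mem_productCone h1 h2)
    (subset_closure (zero_mem_productCone A)) h

variable {ι : Type*} (e : HilbertBasis ι ℂ H)

/-- For `σ` a positive functional and `T` a positive operator, the functional
`a ⊗ b ↦ σ(a) Tr(T bᵗ)` is separable. -/
theorem lift_smulRight_traceForm_mem_separableCone {A : OperatorSystem K} {σ : A.Elem →L[ℂ] ℂ}
    (hσ : ∀ a : A.Elem, (a : K →L[ℂ] K).IsPositive → 0 ≤ σ a) {T : H →L[ℂ] H}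
    (hT : T.IsPositive) :
    StrongDual.toWeakDual (ProjTensor.lift (σ.smulRight (traceForm e T)))
      ∈ separableCone H A := by
  refine mem_closure_of_tendsto (b := Filter.atTop)
    (f := fun s => productFunctional σ (finTraceForm e s T))
    (ProjTensor.tendsto_lift (M := ‖σ‖ * (‖traceForm e‖ * ‖T‖)) (fun s => ?_) fun a b => ?_)
    (Filter.Eventually.of_forall fun s => productFunctional_mem_productCone hσ
      (fun b hb => finTraceForm_nonneg e s hT hb) (continuous_finTraceForm_wot e s T))
  · rw [ContinuousLinearMap.norm_smulRight_apply]
    exact mul_le_mul_of_nonneg_left (norm_finTraceForm_comp_op_le e s T) (norm_nonneg _)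
  · exact (tendsto_finTraceForm e T b).const_mul (σ a)

/-- The double commutant of a commutative self-adjoint set of operators is commutative. -/
theorem StarSubalgebra.mul_comm_of_mem_centralizer_centralizer
    (C : NonUnitalStarSubalgebra ℂ (H →L[ℂ] H)) (hC : ∀ x ∈ C, ∀ y ∈ C, x * y = y * x)
    {x y : H →L[ℂ] H}
    (hx : x ∈ StarSubalgebra.centralizer ℂ (StarSubalgebra.centralizer ℂ (C : Set (H →L[ℂ] H)) :
      Set (H →L[ℂ] H)))
    (hy : y ∈ StarSubalgebra.centralizer ℂ (StarSubalgebra.centralizer ℂ (C : Set (H →L[ℂ] H)) :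
      Set (H →L[ℂ] H))) : x * y = y * x := by
  -- `C` is commutative and self-adjoint, hence contained in its commutant. Therefore the double
  -- commutant lies in the commutant, whose elements commute with `x`.
  have hCC : (C : Set (H →L[ℂ] H)) ⊆ StarSubalgebra.centralizer ℂ (C : Set (H →L[ℂ] H)) := by
    intro z hz
    rw [SetLike.mem_coe, StarSubalgebra.mem_centralizer_iff]
    exact fun w hw => ⟨hC w hw z hz, hC _ (star_mem hw) z hz⟩
  rw [StarSubalgebra.mem_centralizer_iff] at hx
  refine ((hx y ?_).1).symm
  rw [SetLike.mem_coe, StarSubalgebra.mem_centralizer_iff]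
  rw [StarSubalgebra.mem_centralizer_iff] at hy
  exact fun w hw => hy w (hCC hw)

end

/-! ### Factorisation through a commutative C⋆-algebra -/

section

variable {K : Type*} [NormedAddCommGroup K] [InnerProductSpace ℂ K] [CompleteSpace K]
  {H : Type*} [NormedAddCommGroup H] [InnerProductSpace ℂ H] [CompleteSpace H]

open WeakDual in
/-- A map that factors positively through a commutative C⋆-algebra represented on `H` is
approximated on finite sets by maps `a ↦ ∑ σᵢ(a) Tᵢ` with `σᵢ` and `Tᵢ` positive. -/
theorem exists_separable_approx {ι : Type*} (e : HilbertBasis ι ℂ H) {A : OperatorSystem K}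
    {R : Type*} [CommCStarAlgebra R] (j : R →⋆ₐ[ℂ] (H →L[ℂ] H)) (hj : ∀ x, ‖j x‖ = ‖x‖)
    (ψ : A.Elem →L[ℂ] R)
    (hψ : ∀ a : A.Elem, (a : K →L[ℂ] K).IsPositive → ∀ χ : characterSpace ℂ R, 0 ≤ χ (ψ a))
    (F : Finset A.Elem) {ε : ℝ} (hε : 0 < ε) :
    ∃ φ' : A.Elem →L[ℂ] (H →L[ℂ] H), ‖φ'‖ ≤ ‖ψ‖ ∧ (∀ a ∈ F, ‖j (ψ a) - φ' a‖ ≤ ε) ∧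
      StrongDual.toWeakDual (ProjTensor.lift (dualForm e φ')) ∈ separableCone H A := by
  classical
  obtain ⟨t, g, h1, h2⟩ := CommCStarAlgebra.exists_partition_approx (F.image ψ) hε
  let σ : t → A.Elem →L[ℂ] ℂ := fun i =>
    (CharacterSpace.toCLM (i : characterSpace ℂ R)).comp ψ
  let φ' : A.Elem →L[ℂ] (H →L[ℂ] H) := ∑ i : t, (σ i).smulRight (j (star (g i) * g i))
  have key : ∀ a, φ' a
      = j (∑ i : t, (i : characterSpace ℂ R) (ψ a) • (star (g i) * g i)) := fun a => by
    simp only [φ', sum_apply, ContinuousLinearMap.smulRight_apply, map_sum, map_smul]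
    rfl
  refine ⟨φ', ContinuousLinearMap.opNorm_le_bound _ ψ.opNorm_nonneg fun a => ?_,
    fun a ha => ?_, ?_⟩
  · rw [key, hj]
    exact (h1 _).trans (ψ.le_opNorm a)
  · rw [key, ← map_sub, hj]
    exact h2 _ (Finset.mem_image_of_mem _ ha)
  · have hsum : StrongDual.toWeakDual (ProjTensor.lift (dualForm e φ')) = ∑ i : t,
        StrongDual.toWeakDual (ProjTensor.lift
          ((σ i).smulRight (traceForm e (j (star (g i) * g i))))) := by
      refine ProjTensor.dual_ext fun a b => ?_
      have h : ∀ B : A.Elem →L[ℂ] TraceClass H →L[ℂ] ℂ,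
          StrongDual.toWeakDual (ProjTensor.lift B) (ProjTensor.tmul a b) = B a b :=
        fun B => ProjTensor.lift_tmul B a b
      have hs : ∀ (f : t → WeakDual ℂ (ProjTensor A.Elem (TraceClass H))) z,
          (∑ i, f i) z = ∑ i, f i z := fun f z =>
        map_sum ((topDualPairing ℂ (ProjTensor A.Elem (TraceClass H))).flip z) f _
      rw [h, hs, dualForm_eq, ContinuousLinearMap.comp_apply]
      simp only [h, φ', sum_apply, map_sum, ContinuousLinearMap.smulRight_apply, map_smul]
    rw [hsum]
    refine sum_mem_separableCone _ fun i _ =>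
      lift_smulRight_traceForm_mem_separableCone e (fun a ha => hψ a ha _) ?_
    rw [map_mul, map_star, ← ContinuousLinearMap.nonneg_iff_isPositive]
    exact star_mul_self_nonneg _

-- The approximants on finite sets form a bounded net converging to `φ` pointwise in norm, so their
-- dual functionals converge weak-*.
open Filter Topology WeakDual in
theorem tilde_mem_separableCone_of_factorization {ι : Type*} (e : HilbertBasis ι ℂ H)
    {A : OperatorSystem K} {R : Type*} [CommCStarAlgebra R] (j : R →⋆ₐ[ℂ] (H →L[ℂ] H))
    (hj : ∀ x, ‖j x‖ = ‖x‖) (ψ : A.Elem →L[ℂ] R)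
    (hψ : ∀ a : A.Elem, (a : K →L[ℂ] K).IsPositive → ∀ χ : characterSpace ℂ R, 0 ≤ χ (ψ a))
    (φ : A.Elem →L[ℂ] (H →L[ℂ] H)) (hφ : ∀ a, φ a = j (ψ a)) :
    tilde e φ ∈ separableCone H A := by
  classical
  -- The net is indexed by a finite set of elements together with a precision `1 / (n + 1)`.
  choose φ' hn ha hs using fun p : Finset A.Elem × ℕ =>
    exists_separable_approx e j hj ψ hψ p.1 (ε := 1 / ((p.2 : ℝ) + 1)) (by positivity)
  have hlim : Tendsto (fun p => StrongDual.toWeakDual (ProjTensor.lift (dualForm e (φ' p)))) atTop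
      (𝓝 (tilde e φ)) := by
    refine ProjTensor.tendsto_lift (M := ‖traceForm e‖ * ‖ψ‖) (fun p => ?_) fun a b => ?_
    · rw [dualForm_eq]
      exact (ContinuousLinearMap.opNorm_comp_le _ _).trans
        (mul_le_mul_of_nonneg_left (hn p) (norm_nonneg _))
    · have hφ' : Tendsto (fun p => φ' p a) atTop (𝓝 (φ a)) := by
        have hz : Tendsto (fun p : Finset A.Elem × ℕ => 1 / ((p.2 : ℝ) + 1)) atTop (𝓝 0) := by
          rw [← prod_atTop_atTop_eq]
          exact tendsto_one_div_add_atTop_nhds_zero_nat.comp tendsto_snd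
        rw [tendsto_iff_norm_sub_tendsto_zero]
        refine squeeze_zero' (Eventually.of_forall fun _ => norm_nonneg _) ?_ hz
        filter_upwards [eventually_ge_atTop (({a}, 0) : Finset A.Elem × ℕ)] with p hp
        rw [norm_sub_rev, hφ]
        exact ha p a (hp.1 (Finset.mem_singleton_self a))
      exact ((((traceForm e).flip b).continuous.tendsto _).comp hφ')
  have := mem_closure_of_tendsto hlim (Eventually.of_forall hs)
  rwa [separableCone, closure_closure] at this

end

open WeakDual in
theorem mainTheorem2
    {K : Type*} [NormedAddCommGroup K] [InnerProductSpace ℂ K] [CompleteSpace K]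
    {H : Type*} [NormedAddCommGroup H] [InnerProductSpace ℂ H] [CompleteSpace H]
    [TopologicalSpace.SeparableSpace H]
    {ι : Type*} (e : HilbertBasis ι ℂ H)
    (A : OperatorSystem K) (φ : A.Elem →L[ℂ] (H →L[ℂ] H)) (hφ : IsPositiveMap φ)
    (C : NonUnitalStarSubalgebra ℂ (H →L[ℂ] H)) (hC_closed : IsClosed (C : Set (H →L[ℂ] H)))
    (hC_comm : ∀ x ∈ C, ∀ y ∈ C, x * y = y * x) (hφC : ∀ a, φ a ∈ C) :
    tilde e φ ∈ separableCone H A := by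
  -- `C` may lack the identity operator. Its double commutant is unital, norm closed and still
  -- commutative, so it is a C⋆-algebra with enough characters.
  let W : StarSubalgebra ℂ (H →L[ℂ] H) := StarSubalgebra.centralizer ℂ
    (StarSubalgebra.centralizer ℂ (C : Set (H →L[ℂ] H)) : Set (H →L[ℂ] H))
  have hW : IsClosed (W : Set (H →L[ℂ] H)) := Set.isClosed_centralizer _
  have hφW : ∀ a, φ a ∈ W := fun a => by
    rw [StarSubalgebra.mem_centralizer_iff]
    intro z hz
    have hz' := star_mem hz
    rw [SetLike.mem_coe] at hz
    rw [StarSubalgebra.mem_centralizer_iff] at hz hz'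
    exact ⟨((hz _ (hφC a)).1).symm, ((hz' _ (hφC a)).1).symm⟩
  let _ : CommCStarAlgebra W :=
    { StarSubalgebra.cstarAlgebra W with
      mul_comm := fun x y => Subtype.ext
        (StarSubalgebra.mul_comm_of_mem_centralizer_centralizer C hC_comm x.2 y.2) }
  let ψ : A.Elem →L[ℂ] W := φ.codRestrict W.toSubalgebra.toSubmodule hφW
  refine tilde_mem_separableCone_of_factorization e W.subtype (fun _ => rfl) ψ
    (fun a ha χ => ?_) φ fun _ => rfl
  -- Characters take values in the spectrum, which is the same in the closed star subalgebra `W` as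
  -- in `B(H)`, hence nonnegative for a positive operator.
  have hmem : χ (ψ a) ∈ spectrum ℂ (ψ a) := AlgHom.apply_mem_spectrum χ (ψ a)
  rw [StarSubalgebra.spectrum_eq] at hmem
  have hpos : (0 : H →L[ℂ] H) ≤ φ a := (ContinuousLinearMap.nonneg_iff_isPositive _).2 (hφ a ha)
  exact spectrum_nonneg_of_nonneg hpos hmem
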